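/- Let $\theta\in\mathbb{R}$ and $s_1>0$. Let $\hat\theta_1\sim N(\theta,s_1^2)$ and $\hat\theta_2\sim N(\theta+b_2,s_2^2)$ be random variables on a common probability space (with arbitrary dependence), where $b_2\in\mathbb{R}$, $s_2\ge 0$ (with $N(m,0)$ the point mass at $m$), and the two estimators of $\theta$ have equal mean squared error: $b_2^2+s_2^2=s_1^2$. For $0<\alpha<1$ let $z_{1-\alpha/2}$ be the $(1-\alpha/2)$-quantile of the standard normal distribution, and put $$\mathrm{CI}_1=[\hat\theta_1- z_{1-\alpha/2}s_1,\ \hat\theta_1+ z_{1-\alpha/2}s_1],\qquad \mathrm{CI}_2=[\hat\theta_2- z_{1-\alpha/2}s_1,\ \hat\theta_2+ z_{1-\alpha/2}s_1].$$ The coverage probability of $\mathrm{CI}_i$ is $\Pr(\theta\in\mathrm{CI}_i)$. Then: 1. For every $0<\alpha<1$, the coverage probability of $\mathrm{CI}_1$ equals $1-\alpha$. 2. For every $\alpha>0$ with $1-\alpha\ge 0.917$, the coverage probability of $\mathrm{CI}_2$ is strictly greater than $1-\alpha$ whenever $b_2\neq 0$. 3. For $1-\alpha=0.9$ and any $b_2$,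 the coverage probability of $\mathrm{CI}_2$ is at least $0.89995$ (that is, at least $90.00\%$ after rounding). 4. For $1-\alpha=0.9$, with $\theta$ and $s_1$ fixed, the coverage probability of $\mathrm{CI}_2$ tends to $1$ as $|b_2|\to s_1$, and it is strictly increasing in $|b_2|$ for $|b_2|$ close enough to $s_1$: there is $\beta<s_1$ such that it is strictly increasing in $|b_2|$ on $[\beta,s_1]$. -/

import Mathlib

open MeasureTheory ProbabilityTheory Filter Topology

/-- The `p`-quantile of a probability distribution on the real line. -/
noncomputable def quantile (μ : Measure ℝ) (p : ℝ) : ℝ :=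
  sInf {x : ℝ | p ≤ cdf μ x}

/-- The critical value `z_p`: the `p`-quantile of the standard normal distribution. -/
noncomputable def zCrit (p : ℝ) : ℝ :=
  quantile (gaussianReal 0 1) p

/-- The normal distribution with mean `m` and standard deviation `s`
(a point mass at `m` if `s = 0`). -/
noncomputable def normalDist (m s : ℝ) : Measure ℝ :=
  gaussianReal m (s ^ 2).toNNReal

/-- The probability that the random set `CI` contains the parameter value `θ`. -/
noncomputable def coverageProb {Ω : Type*} [MeasurableSpace Ω] (P : Measure Ω)
    (CI : Ω → Set ℝ) (θ : ℝ) : ℝ :=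
  P.real {ω | θ ∈ CI ω}

universe u

/-- Two estimators of `θ`, on a common probability space and with arbitrary dependence:
`est₁ ∼ N(θ, s₁²)` is unbiased, `est₂ ∼ N(θ + b₂, s₂²)` has bias `b₂`, and their mean squared
errors `s₁²` and `b₂² + s₂²` are equal. -/
structure EqualMSEModel (θ s₁ : ℝ) where
  Ω : Type u
  [mΩ : MeasurableSpace Ω]
  P : Measure Ω
  [prob : IsProbabilityMeasure P]
  est₁ : Ω → ℝ
  est₂ : Ω → ℝ
  b₂ : ℝ
  s₂ : ℝ
  s₂_nonneg : 0 ≤ s₂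
  law₁ : HasLaw est₁ (normalDist θ s₁) P
  law₂ : HasLaw est₂ (normalDist (θ + b₂) s₂) P
  equal_mse : b₂ ^ 2 + s₂ ^ 2 = s₁ ^ 2

attribute [instance] EqualMSEModel.mΩ EqualMSEModel.prob

namespace EqualMSEModel

variable {θ s₁ : ℝ}

/-- `CI₁ = est₁ ± z_{1-α/2} s₁`. -/
noncomputable def CI₁ (M : EqualMSEModel.{u} θ s₁) (α : ℝ) (ω : M.Ω) : Set ℝ :=
  Set.Icc (M.est₁ ω - zCrit (1 - α / 2) * s₁) (M.est₁ ω + zCrit (1 - α / 2) * s₁)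

/-- `CI₂ = est₂ ± z_{1-α/2} s₁`: centred at the biased estimator, with the standard error of the
unbiased one. -/
noncomputable def CI₂ (M : EqualMSEModel.{u} θ s₁) (α : ℝ) (ω : M.Ω) : Set ℝ :=
  Set.Icc (M.est₂ ω - zCrit (1 - α / 2) * s₁) (M.est₂ ω + zCrit (1 - α / 2) * s₁)

/-- Coverage probability of `CI₁` at nominal level `1 - α`. -/
noncomputable def CP₁ (M : EqualMSEModel.{u} θ s₁) (α : ℝ) : ℝ :=
  coverageProb M.P (M.CI₁ α) θ

/-- Coverage probability of `CI₂` at nominal level `1 - α`. -/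
noncomputable def CP₂ (M : EqualMSEModel.{u} θ s₁) (α : ℝ) : ℝ :=
  coverageProb M.P (M.CI₂ α) θ

end EqualMSEModel

/-! Let `q = |b₂| / s₂`. Equal mean squared errors give `s₁ / s₂ = √(1 + q²)`, so the coverage of
`CI₂` depends on `z` and `q` alone: it is `coverage z q`, with value `1 - α` at `q = 0`. Its
derivative in `q` has the sign of `ρ y cosh y - sinh y`, where `y = z q √(1 + q²)` and `ρ = 1 / (1 +
q²)`.

For `q ≥ 1` this is positive as soon as `z² ≥ 2` (`coverageDeriv_pos_of_one_le`). For `q ≤ 1` every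
power series term after the first is nonnegative, and three terms yield the lower bound
`coverageSlope`, which tends to `z² / 3 - 1` as `q → 0`. Hence coverage increases when `z² ≥ 3`, and
the level 0.917 lies just above the one with `z = √3`. At level 0.9 the derivative may be negative
near `q = 0`; integrating an explicit polynomial bound over that range limits the loss to 0.00005
(`coverage_ge`).

Near `|b₂| = s₁`, Chebyshev's inequality gives the limit 1 and the range `q ≥ 1` gives monotonicity.
The degenerate case `s₂ = 0` has coverage exactly 1. -/

/-! ### Standard normal integral, distribution function and quantiles. -/

/-- The standard normal density. -/
noncomputable def stdNormalPDF (x : ℝ) : ℝ :=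
  (√(2 * Real.pi))⁻¹ * Real.exp (-x ^ 2 / 2)

/-- The standard normal probability of the interval from `0` to `x`. -/
noncomputable def stdNormalIntegral (x : ℝ) : ℝ :=
  ∫ t in (0 : ℝ)..x, stdNormalPDF t

lemma gaussianPDFReal_zero_one : gaussianPDFReal 0 1 = stdNormalPDF := by
  ext x
  simp [gaussianPDFReal, stdNormalPDF]

lemma stdNormalPDF_pos (x : ℝ) : 0 < stdNormalPDF x := by
  unfold stdNormalPDF
  positivity

lemma continuous_stdNormalPDF : Continuous stdNormalPDF := by
  unfold stdNormalPDF
  fun_prop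

lemma hasDerivAt_stdNormalIntegral (x : ℝ) :
    HasDerivAt stdNormalIntegral (stdNormalPDF x) x :=
  intervalIntegral.integral_hasDerivAt_right (continuous_stdNormalPDF.intervalIntegrable _ _)
    (continuous_stdNormalPDF.stronglyMeasurableAtFilter _ _) continuous_stdNormalPDF.continuousAt

lemma continuous_stdNormalIntegral : Continuous stdNormalIntegral :=
  continuous_iff_continuousAt.2 fun x => (hasDerivAt_stdNormalIntegral x).continuousAt

lemma strictMono_stdNormalIntegral : StrictMono stdNormalIntegral :=
  strictMono_of_deriv_pos fun x => by
    rw [(hasDerivAt_stdNormalIntegral x).deriv]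
    exact stdNormalPDF_pos x

@[simp]
lemma stdNormalIntegral_zero : stdNormalIntegral 0 = 0 := by
  simp [stdNormalIntegral]

@[simp]
lemma stdNormalIntegral_neg (x : ℝ) : stdNormalIntegral (-x) = -stdNormalIntegral x := by
  have h := intervalIntegral.integral_comp_neg (a := 0) (b := x) stdNormalPDF
  have heven : (fun t => stdNormalPDF (-t)) = stdNormalPDF := by
    ext t
    simp [stdNormalPDF]
  rw [heven, neg_zero, intervalIntegral.integral_symm 0 (-x)] at h
  unfold stdNormalIntegral
  linarith

lemma gaussianReal_real_Icc {a b : ℝ} (hab : a ≤ b) :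
    (gaussianReal 0 1).real (Set.Icc a b) = stdNormalIntegral b - stdNormalIntegral a := by
  have hI (x y : ℝ) := continuous_stdNormalPDF.intervalIntegrable (μ := volume) x y
  rw [Measure.real, gaussianReal_apply_eq_integral 0 one_ne_zero, gaussianPDFReal_zero_one,
    ENNReal.toReal_ofReal (integral_nonneg fun x => (stdNormalPDF_pos x).le),
    integral_Icc_eq_integral_Ioc, ← intervalIntegral.integral_of_le hab]
  unfold stdNormalIntegral
  rw [intervalIntegral.integral_interval_sub_left (hI _ _) (hI _ _)]

lemma cdf_gaussianReal_zero_one_zero : cdf (gaussianReal 0 1) 0 = 1 / 2 := by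
  have hmap : (gaussianReal 0 1).real (Set.Ici 0) = (gaussianReal 0 1).real (Set.Iic 0) := by
    conv_lhs => rw [← neg_zero, ← gaussianReal_map_neg]
    rw [map_measureReal_apply measurable_neg measurableSet_Ici]
    congr 1
    ext x
    simp
  have := nullSingletonClass_gaussianReal (μ := 0) (v := 1) one_ne_zero
  have hIoi : (gaussianReal 0 1).real (Set.Ioi 0) = (gaussianReal 0 1).real (Set.Ici 0) :=
    measureReal_congr Ioi_ae_eq_Ici
  have hcompl := probReal_compl_eq_one_sub (μ := gaussianReal 0 1) (measurableSet_Iic (a := (0 : ℝ)))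
  rw [Set.compl_Iic, hIoi, hmap] at hcompl
  rw [cdf_eq_real]
  linarith

lemma cdf_gaussianReal_zero_one (x : ℝ) :
    cdf (gaussianReal 0 1) x = 1 / 2 + stdNormalIntegral x := by
  have h (a b : ℝ) (hab : a ≤ b) : cdf (gaussianReal 0 1) b - cdf (gaussianReal 0 1) a =
      stdNormalIntegral b - stdNormalIntegral a := by
    have := nullSingletonClass_gaussianReal (μ := 0) (v := 1) one_ne_zero
    rw [← gaussianReal_real_Icc hab, cdf_eq_real, cdf_eq_real,
      ← measureReal_sdiff (Set.Iic_subset_Iic.2 hab) measurableSet_Iic, Set.Iic_sdiff_Iic]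
    exact measureReal_congr Ioc_ae_eq_Icc
  have h0 := cdf_gaussianReal_zero_one_zero
  rcases le_total 0 x with hx | hx
  · have := h 0 x hx
    rw [h0, stdNormalIntegral_zero] at this
    linarith
  · have := h x 0 hx
    rw [h0, stdNormalIntegral_zero] at this
    linarith

lemma stdNormalIntegral_lt_half (x : ℝ) : stdNormalIntegral x < 1 / 2 := by
  have h := cdf_le_one (gaussianReal 0 1) (x + 1)
  rw [cdf_gaussianReal_zero_one] at h
  have := strictMono_stdNormalIntegral (lt_add_one x)
  linarith

/-- Continuity makes the superlevel set closed, so its infimum belongs to it; a point where the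
value `p` is attained bounds the infimum from above. -/
lemma cdf_quantile {μ : Measure ℝ} (hμ : Continuous (cdf μ)) {p : ℝ} (h0 : 0 < p) (h1 : p < 1) :
    cdf μ (quantile μ p) = p := by
  obtain ⟨x, hx⟩ : ∃ x, cdf μ x = p := by
    have := mem_range_of_exists_le_of_exists_ge hμ
      (((tendsto_cdf_atBot μ).eventually_le_const h0).exists)
      (((tendsto_cdf_atTop μ).eventually_const_le h1).exists)
    exact this
  have hbdd : BddBelow {x : ℝ | p ≤ cdf μ x} := by
    obtain ⟨y, hy⟩ := ((tendsto_cdf_atBot μ).eventually_lt_const h0).exists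
    exact ⟨y, fun w hw => le_of_not_gt fun hlt =>
      absurd ((hw.trans (monotone_cdf μ hlt.le)).trans_lt hy) (lt_irrefl _)⟩
  have hclosed : IsClosed {x : ℝ | p ≤ cdf μ x} := isClosed_le continuous_const hμ
  refine le_antisymm ?_ (hclosed.csInf_mem ⟨x, hx.ge⟩ hbdd)
  exact (monotone_cdf μ (csInf_le hbdd hx.ge)).trans hx.le

lemma two_mul_stdNormalIntegral_zCrit {α : ℝ} (h0 : 0 < α) (h1 : α < 1) :
    2 * stdNormalIntegral (zCrit (1 - α / 2)) = 1 - α := by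
  have hc : Continuous (cdf (gaussianReal 0 1)) := by
    rw [show (cdf (gaussianReal 0 1) : ℝ → ℝ) = fun x => 1 / 2 + stdNormalIntegral x from
      funext cdf_gaussianReal_zero_one]
    exact continuous_const.add continuous_stdNormalIntegral
  have h := cdf_quantile hc (p := 1 - α / 2) (by linarith) (by linarith)
  rw [cdf_gaussianReal_zero_one] at h
  unfold zCrit
  linarith

lemma normalDist_real_Icc {m s a b : ℝ} (hs : 0 < s) (hab : a ≤ b) :
    (normalDist m s).real (Set.Icc a b) =
      stdNormalIntegral ((b - m) / s) - stdNormalIntegral ((a - m) / s) := by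
  have hmap : (gaussianReal 0 1).map (fun x => m + s * x) = normalDist m s := by
    rw [← Function.comp_def (fun x => m + x) (fun x => s * x),
      ← Measure.map_map (by fun_prop) (by fun_prop), gaussianReal_map_const_mul,
      gaussianReal_map_const_add, normalDist]
    congr 1
    · simp
    · ext
      simp [Real.coe_toNNReal _ (sq_nonneg s)]
  rw [← hmap, map_measureReal_apply (by fun_prop) measurableSet_Icc,
    ← gaussianReal_real_Icc (by gcongr)]
  congr 1
  ext x
  simp only [Set.mem_preimage, Set.mem_Icc, div_le_iff₀ hs, le_div_iff₀ hs]
  constructor <;> rintro ⟨h1, h2⟩ <;> constructor <;> linarith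

/-! ### Numerical bounds for normal probabilities from Maclaurin series. -/

/-- The alternating partial sums of odd length of the exponential series bound `exp (-u)` from
above, and those of even length from below. -/
lemma neg_one_pow_mul_exp_neg_sub_sum_nonneg (n : ℕ) {u : ℝ} (hu : 0 ≤ u) :
    0 ≤ (-1) ^ n * (Real.exp (-u) - ∑ k ∈ Finset.range n, (-u) ^ k / (k.factorial : ℝ)) := by
  induction n generalizing u with
  | zero => simpa using (Real.exp_pos _).le
  | succ n ih =>
    -- Differentiating the signed remainder of length `n + 1` gives the one of length `n`. It
    -- vanishes at 0, so it inherits nonnegativity by monotonicity.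
    have hd (x : ℝ) : HasDerivAt (fun u : ℝ => (-1) ^ (n + 1) * (Real.exp (-u) -
        ∑ k ∈ Finset.range (n + 1), (-u) ^ k / (k.factorial : ℝ)))
        ((-1) ^ n * (Real.exp (-x) - ∑ k ∈ Finset.range n, (-x) ^ k / (k.factorial : ℝ))) x := by
      have hsum : HasDerivAt (fun u : ℝ =>
          ∑ k ∈ Finset.range (n + 1), (-u) ^ k / (k.factorial : ℝ))
          (-∑ k ∈ Finset.range n, (-x) ^ k / (k.factorial : ℝ)) x := by
        simp only [Finset.sum_range_succ']
        rw [← Finset.sum_neg_distrib]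
        simp only [pow_zero]
        refine HasDerivAt.add_const _ (HasDerivAt.fun_sum fun k _ => ?_)
        have := (((hasDerivAt_id x).neg.pow (k + 1)).div_const ((k + 1).factorial : ℝ))
        refine this.congr_deriv ?_
        rw [Nat.factorial_succ]
        push_cast
        have : (k.factorial : ℝ) ≠ 0 := by positivity
        simp only [id, Pi.neg_apply]
        field_simp
      refine (((hasDerivAt_id x).neg.exp.sub hsum).const_mul _).congr_deriv ?_
      simp only [id, Pi.neg_apply]
      ring
    have hmono : MonotoneOn (fun u : ℝ => (-1) ^ (n + 1) * (Real.exp (-u) -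
        ∑ k ∈ Finset.range (n + 1), (-u) ^ k / (k.factorial : ℝ))) (Set.Ici 0) := by
      refine monotoneOn_of_deriv_nonneg (convex_Ici 0)
        (fun x _ => (hd x).continuousAt.continuousWithinAt)
        (fun x _ => (hd x).differentiableAt.differentiableWithinAt) fun x hx => ?_
      rw [interior_Ici] at hx
      rw [(hd x).deriv]
      exact ih (le_of_lt hx)
    have := hmono (Set.mem_Ici.2 le_rfl) (Set.mem_Ici.2 hu) hu
    simpa [Finset.sum_range_succ'] using this

lemma exp_neg_le_sum_of_odd {n : ℕ} (hn : Odd n) {u : ℝ} (hu : 0 ≤ u) :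
    Real.exp (-u) ≤ ∑ k ∈ Finset.range n, (-u) ^ k / (k.factorial : ℝ) := by
  have := neg_one_pow_mul_exp_neg_sub_sum_nonneg n hu
  rw [hn.neg_one_pow] at this
  linarith

/-- Upper bound for the standard normal integral by a partial sum of its Maclaurin series. -/
lemma stdNormalIntegral_le_sum {n : ℕ} (hn : Odd n) {a : ℝ} (ha : 0 ≤ a) :
    stdNormalIntegral a ≤ (√(2 * Real.pi))⁻¹ * ∑ k ∈ Finset.range n,
      (-1 / 2) ^ k * a ^ (2 * k + 1) / ((k.factorial : ℝ) * (2 * k + 1)) := by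
  have hint : ∫ t in (0 : ℝ)..a, (√(2 * Real.pi))⁻¹ *
      ∑ k ∈ Finset.range n, (-1 / 2) ^ k / (k.factorial : ℝ) * t ^ (2 * k) =
      (√(2 * Real.pi))⁻¹ * ∑ k ∈ Finset.range n,
      (-1 / 2) ^ k * a ^ (2 * k + 1) / ((k.factorial : ℝ) * (2 * k + 1)) := by
    rw [intervalIntegral.integral_const_mul, intervalIntegral.integral_finsetSum
      fun k _ => Continuous.intervalIntegrable (by fun_prop) _ _]
    congr 1
    refine Finset.sum_congr rfl fun k _ => ?_
    rw [intervalIntegral.integral_const_mul, integral_pow]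
    push_cast
    have : (k.factorial : ℝ) ≠ 0 := by positivity
    field_simp
    simp
  rw [← hint]
  refine intervalIntegral.integral_mono_on ha
    (continuous_stdNormalPDF.intervalIntegrable _ _)
    (Continuous.intervalIntegrable (by fun_prop) _ _) fun t _ => ?_
  unfold stdNormalPDF
  gcongr
  have := exp_neg_le_sum_of_odd hn (u := t ^ 2 / 2) (by positivity)
  refine (le_of_eq (by ring_nf)).trans (this.trans (le_of_eq ?_))
  refine Finset.sum_congr rfl fun k _ => ?_
  rw [pow_mul, show -(t ^ 2 / 2) = (-1 / 2) * t ^ 2 by ring, mul_pow]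
  ring

lemma inv_sqrt_two_pi_lt : (√(2 * Real.pi))⁻¹ < 0.39896 := by
  have h : (2.50659 : ℝ) < √(2 * Real.pi) := by
    apply Real.lt_sqrt_of_sq_lt
    have := Real.pi_gt_d4
    norm_num at this ⊢
    linarith
  have : (√(2 * Real.pi))⁻¹ < (2.50659 : ℝ)⁻¹ := inv_strictAnti₀ (by norm_num) h
  refine this.trans ?_
  norm_num

lemma two_mul_stdNormalIntegral_lt_of_sum_le {n : ℕ} (hn : Odd n) {a c p : ℝ} (ha : 0 ≤ a)
    (hsum : ∑ k ∈ Finset.range n, (-1 / 2 : ℝ) ^ k * a ^ (2 * k + 1) /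
      ((k.factorial : ℝ) * (2 * k + 1)) ≤ c) (hc : 0 < c) (hp : 2 * (0.39896 * c) ≤ p) :
    2 * stdNormalIntegral a < p := by
  have h1 := stdNormalIntegral_le_sum hn ha
  have h2 : (√(2 * Real.pi))⁻¹ * ∑ k ∈ Finset.range n, (-1 / 2 : ℝ) ^ k * a ^ (2 * k + 1) /
      ((k.factorial : ℝ) * (2 * k + 1)) ≤ (√(2 * Real.pi))⁻¹ * c := by gcongr
  have h3 := mul_lt_mul_of_pos_right inv_sqrt_two_pi_lt hc
  linarith

/-- The point 1.644 lies slightly below the true critical value 1.6448…; the constant `c` is the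
nine-term series sum rounded up. -/
lemma two_mul_stdNormalIntegral_lt_nine_tenths : 2 * stdNormalIntegral 1.644 < 0.9 :=
  two_mul_stdNormalIntegral_lt_of_sum_le (n := 9) (c := 1.1278) (by decide) (by norm_num)
    (by norm_num [Finset.sum_range_succ, Nat.factorial]) (by norm_num) (by norm_num)

/-- The point 1.7325 is chosen just above `√3`, the threshold for increasing coverage. -/
lemma two_mul_stdNormalIntegral_lt_917 : 2 * stdNormalIntegral 1.7325 < 0.917 :=
  two_mul_stdNormalIntegral_lt_of_sum_le (n := 9) (c := 1.1491) (by decide) (by norm_num)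
    (by norm_num [Finset.sum_range_succ, Nat.factorial]) (by norm_num) (by norm_num)

lemma le_zCrit {α a : ℝ} (h0 : 0 < α) (h1 : α < 1) (ha : 2 * stdNormalIntegral a ≤ 1 - α) :
    a ≤ zCrit (1 - α / 2) := by
  rw [← strictMono_stdNormalIntegral.le_iff_le]
  linarith [two_mul_stdNormalIntegral_zCrit h0 h1]

/-! ### Coverage as a function of the ratio of bias to standard deviation. -/

/-- The coverage probability of `est ± z s₁` when the ratio of bias to standard deviation of the
estimator is `q` and its root mean squared error is `s₁`. -/
noncomputable def coverage (z q : ℝ) : ℝ :=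
  stdNormalIntegral (z * √(1 + q ^ 2) - q) + stdNormalIntegral (z * √(1 + q ^ 2) + q)

/-- The derivative of `coverage z` at `q`. -/
noncomputable def coverageDeriv (z q : ℝ) : ℝ :=
  2 * stdNormalPDF z * Real.exp (-((z ^ 2 + 1) / 2 * q ^ 2)) *
    (z * q / √(1 + q ^ 2) * Real.cosh (z * q * √(1 + q ^ 2)) - Real.sinh (z * q * √(1 + q ^ 2)))

lemma coverage_zero (z : ℝ) : coverage z 0 = 2 * stdNormalIntegral z := by
  simp [coverage, two_mul]

lemma coverage_lt_one (z q : ℝ) : coverage z q < 1 := by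
  have h1 := stdNormalIntegral_lt_half (z * √(1 + q ^ 2) - q)
  have h2 := stdNormalIntegral_lt_half (z * √(1 + q ^ 2) + q)
  unfold coverage
  linarith

lemma stdNormalPDF_mul_sqrt_add (z q : ℝ) :
    stdNormalPDF (z * √(1 + q ^ 2) + q) = stdNormalPDF z *
      Real.exp (-((z ^ 2 + 1) / 2 * q ^ 2)) * Real.exp (-(z * q * √(1 + q ^ 2))) := by
  have hr : √(1 + q ^ 2) ^ 2 = 1 + q ^ 2 := Real.sq_sqrt (by positivity)
  unfold stdNormalPDF
  rw [mul_assoc, mul_assoc, ← Real.exp_add, ← Real.exp_add]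
  congr 2
  linear_combination (-z ^ 2 / 2) * hr

lemma stdNormalPDF_mul_sqrt_sub (z q : ℝ) :
    stdNormalPDF (z * √(1 + q ^ 2) - q) = stdNormalPDF z *
      Real.exp (-((z ^ 2 + 1) / 2 * q ^ 2)) * Real.exp (z * q * √(1 + q ^ 2)) := by
  simpa [sub_eq_add_neg] using stdNormalPDF_mul_sqrt_add z (-q)

lemma hasDerivAt_coverage (z q : ℝ) : HasDerivAt (coverage z) (coverageDeriv z q) q := by
  have hpos : 0 < 1 + q ^ 2 := by positivity
  have hr : HasDerivAt (fun q : ℝ => z * √(1 + q ^ 2)) (z * (q / √(1 + q ^ 2))) q := by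
    have h := (((hasDerivAt_id q).pow 2).const_add 1).sqrt hpos.ne'
    refine (h.const_mul z).congr_deriv ?_
    simp
    left
    field_simp
  have h1 := (hasDerivAt_stdNormalIntegral _).comp q (hr.sub (hasDerivAt_id q))
  have h2 := (hasDerivAt_stdNormalIntegral _).comp q (hr.add (hasDerivAt_id q))
  refine (h1.add h2).congr_deriv ?_
  simp only [Pi.sub_apply, Pi.add_apply, id, stdNormalPDF_mul_sqrt_add, stdNormalPDF_mul_sqrt_sub]
  unfold coverageDeriv
  rw [Real.cosh_eq, Real.sinh_eq]
  ring

lemma continuous_coverage (z : ℝ) : Continuous (coverage z) :=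
  continuous_iff_continuousAt.2 fun q => (hasDerivAt_coverage z q).continuousAt

/-- Where `z q ≥ √(1 + q²)` the derivative of the coverage is positive. -/
lemma coverageDeriv_pos_of_one_le {z q : ℝ} (hz : 0 < z) (hz2 : 2 ≤ z ^ 2) (hq : 1 ≤ q) :
    0 < coverageDeriv z q := by
  have hr : 1 ≤ z * q / √(1 + q ^ 2) := by
    -- After squaring, the claim is `1 + q² ≤ z² q²`, which follows from `1 + q² ≤ 2 q²`.
    rw [one_le_div (by positivity), Real.sqrt_le_left (by positivity), mul_pow]
    nlinarith
  have hc : Real.cosh (z * q * √(1 + q ^ 2)) ≤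
      z * q / √(1 + q ^ 2) * Real.cosh (z * q * √(1 + q ^ 2)) :=
    le_mul_of_one_le_left (Real.cosh_pos _).le hr
  have hs := Real.sinh_lt_cosh (z * q * √(1 + q ^ 2))
  have := stdNormalPDF_pos z
  unfold coverageDeriv
  refine mul_pos (by positivity) (by linarith)

/-! ### Sign of the derivative for `q ≤ 1`. -/

/-- Lower bound for `ρ y cosh y - sinh y` by the first terms of its power series. -/
lemma sum_le_mul_cosh_sub_sinh {ρ y : ℝ} (hy : 0 ≤ y) (hρ : 1 / 3 ≤ ρ) :
    y * ((ρ - 1) + y ^ 2 / 6 * (3 * ρ - 1) + y ^ 4 / 120 * (5 * ρ - 1)) ≤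
      ρ * y * Real.cosh y - Real.sinh y := by
  have h := ((Real.hasSum_cosh y).mul_left (ρ * y)).sub (Real.hasSum_sinh y)
  have hterm (k : ℕ) : ρ * y * (y ^ (2 * k) / ((2 * k).factorial : ℝ)) -
      y ^ (2 * k + 1) / ((2 * k + 1).factorial : ℝ) =
      y ^ (2 * k + 1) / ((2 * k + 1).factorial : ℝ) * ((2 * k + 1) * ρ - 1) := by
    rw [Nat.factorial_succ]
    have : ((2 * k).factorial : ℝ) ≠ 0 := by positivity
    push_cast
    field_simp
    ring
  simp only [hterm] at h
  refine le_trans (le_of_eq ?_) (sum_le_hasSum (Finset.range 3) (fun k hk => ?_) h)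
  · norm_num [Finset.sum_range_succ, Nat.factorial]
    ring
  · have hk : (3 : ℝ) ≤ k := by exact_mod_cast not_lt.1 (Finset.mem_range.not.1 hk)
    have : 0 ≤ (2 * k + 1) * ρ - 1 := by nlinarith
    positivity

/-- The factor that governs the sign of the derivative of the coverage, as a function of
`v = q²`. -/
noncomputable def coverageSlope (z v : ℝ) : ℝ :=
  -1 + z ^ 2 * (1 + v) * (2 - v) / 6 + z ^ 4 * v * (1 + v) ^ 2 * (4 - v) / 120

/-- With `ρ = 1 / (1 + q²) ≥ 1 / 2` the three-term series bound applies; its leading coefficient `ρ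
- 1 = -q² / (1 + q²)` is what allows `q²` to be factored out. -/
lemma le_coverageDeriv {z q : ℝ} (hz : 0 < z) (hq : 0 ≤ q) (hq1 : q ≤ 1) :
    2 * stdNormalPDF z * Real.exp (-((z ^ 2 + 1) / 2 * q ^ 2)) *
      (z * q * q ^ 2 / √(1 + q ^ 2) * coverageSlope z (q ^ 2)) ≤ coverageDeriv z q := by
  have hpos : 0 < 1 + q ^ 2 := by positivity
  have hr : √(1 + q ^ 2) ^ 2 = 1 + q ^ 2 := Real.sq_sqrt hpos.le
  have hr0 : 0 < √(1 + q ^ 2) := Real.sqrt_pos.2 hpos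
  have h := sum_le_mul_cosh_sub_sinh (ρ := 1 / (1 + q ^ 2)) (y := z * q * √(1 + q ^ 2))
    (by positivity) (one_div_le_one_div_of_le hpos (by nlinarith))
  have hρ : 1 / (1 + q ^ 2) * (z * q * √(1 + q ^ 2)) = z * q / √(1 + q ^ 2) := by
    field_simp
    rw [hr]
  rw [hρ] at h
  have := stdNormalPDF_pos z
  unfold coverageDeriv
  gcongr
  refine le_trans (le_of_eq ?_) h
  unfold coverageSlope
  have h4 : √(1 + q ^ 2) ^ 4 = (1 + q ^ 2) ^ 2 := by rw [show 4 = 2 * 2 from rfl, pow_mul, hr]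
  rw [mul_pow, mul_pow _ _ 4, hr, h4]
  generalize √(1 + q ^ 2) = r at *
  field_simp
  rw [hr]
  ring

/-- For `z² ≥ 3` the quadratic term is at least `(1 + v)(2 - v) / 2 ≥ 1` on `[0, 1]`, which cancels
the `-1`; the quartic term makes the inequality strict. -/
lemma coverageSlope_pos {z v : ℝ} (hz : 3 ≤ z ^ 2) (hv : 0 < v) (hv1 : v ≤ 1) :
    0 < coverageSlope z v := by
  have h1 : 3 * ((1 + v) * (2 - v)) ≤ z ^ 2 * ((1 + v) * (2 - v)) := by
    have : 0 ≤ (1 + v) * (2 - v) := mul_nonneg (by linarith) (by linarith)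
    gcongr
  have h2 : 0 < z ^ 4 * v * (1 + v) ^ 2 * (4 - v) := by
    have : 0 < 4 - v := by linarith
    have : 0 < z ^ 4 := by nlinarith
    positivity
  unfold coverageSlope
  nlinarith

lemma strictMonoOn_coverage_Ici {z a : ℝ} (h : ∀ q, a < q → 0 < coverageDeriv z q) :
    StrictMonoOn (coverage z) (Set.Ici a) := by
  refine strictMonoOn_of_deriv_pos (convex_Ici a) (continuous_coverage z).continuousOn
    fun q hq => ?_
  rw [interior_Ici] at hq
  rw [(hasDerivAt_coverage z q).deriv]
  exact h q hq

lemma strictMonoOn_coverage_of_three_le {z : ℝ} (hz : 0 < z) (hz3 : 3 ≤ z ^ 2) :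
    StrictMonoOn (coverage z) (Set.Ici 0) := by
  refine strictMonoOn_coverage_Ici fun q hq => ?_
  rcases le_total 1 q with h1 | h1
  · exact coverageDeriv_pos_of_one_le hz (by linarith) h1
  · refine lt_of_lt_of_le ?_ (le_coverageDeriv hz hq.le h1)
    have := coverageSlope_pos hz3 (v := q ^ 2) (by positivity) (by nlinarith)
    have := stdNormalPDF_pos z
    positivity

lemma strictMonoOn_coverage_Ici_one {z : ℝ} (hz : 0 < z) (hz2 : 2 ≤ z ^ 2) :
    StrictMonoOn (coverage z) (Set.Ici 1) :=
  strictMonoOn_coverage_Ici fun _ hq => coverageDeriv_pos_of_one_le hz hz2 hq.le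

/-! ### Bound on the loss of coverage at level 0.9. -/

lemma le_coverageSlope {z v : ℝ} (hz : 1.644 ≤ z) (hv : 0 ≤ v) (hv1 : v ≤ 1) :
    -0.0991 + 0.692 * v ≤ coverageSlope z v := by
  have hz2 : (2.7027 : ℝ) ≤ z ^ 2 := by nlinarith
  have hz4 : (7.3045 : ℝ) ≤ z ^ 4 := by nlinarith
  have h1 : 2.7027 * ((1 + v) * (2 - v)) ≤ z ^ 2 * ((1 + v) * (2 - v)) := by
    have : 0 ≤ (1 + v) * (2 - v) := mul_nonneg (by linarith) (by linarith)
    gcongr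
  have h2 : 7.3045 * (v * (1 + v) ^ 2 * (4 - v)) ≤ z ^ 4 * (v * (1 + v) ^ 2 * (4 - v)) := by
    have : 0 ≤ v * (1 + v) ^ 2 * (4 - v) := mul_nonneg (by positivity) (by linarith)
    gcongr
  -- What remains after inserting the lower bounds for `z²` and `z⁴`. The true linear coefficient is
  -- about 0.6939; the surplus over 0.692 absorbs the negative quadratic term.
  have h3 : 0 ≤ v * (0.0019 - 0.0244 * v + 0.1217 * v ^ 2 - 0.0609 * v ^ 3) := by
    refine mul_nonneg hv ?_
    nlinarith [sq_nonneg (v - 0.13), mul_nonneg hv (sub_nonneg.2 hv1),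
      mul_nonneg (sq_nonneg v) (sub_nonneg.2 hv1), mul_nonneg hv (sq_nonneg (v - 0.13))]
  unfold coverageSlope
  nlinarith

/-- Squared, this says that `z² exp (-z²) / (2π)` is at most `0.17²`. The tangent line of the
exponential at 2.7027 gives `exp (z²) ≥ 5.51 z²`, which suffices. -/
lemma mul_stdNormalPDF_le {z : ℝ} (hz : 1.644 ≤ z) : z * stdNormalPDF z ≤ 0.17 := by
  have hz2 : (2.7027 : ℝ) ≤ z ^ 2 := by nlinarith
  have hexp : (14.919 : ℝ) ≤ Real.exp 2.7027 := by
    have h := Real.sum_le_exp_of_nonneg (x := 0.9009) (by norm_num) 8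
    norm_num [Finset.sum_range_succ, Nat.factorial] at h
    have h3 : Real.exp 2.7027 = Real.exp 0.9009 ^ 3 := by
      rw [← Real.exp_nat_mul]
      norm_num
    rw [h3]
    norm_num
    refine le_trans ?_ (pow_le_pow_left₀ (by norm_num) h 3)
    norm_num
  have hE : 5.51 * z ^ 2 ≤ Real.exp (z ^ 2) := by
    have h1 := Real.add_one_le_exp (z ^ 2 - 2.7027)
    have h2 : Real.exp (z ^ 2) = Real.exp 2.7027 * Real.exp (z ^ 2 - 2.7027) := by
      rw [← Real.exp_add]
      ring_nf
    rw [h2]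
    refine le_trans ?_ (mul_le_mul hexp h1 (by linarith) (by positivity))
    linarith
  refine (abs_le_of_sq_le_sq' ?_ (by norm_num)).2
  unfold stdNormalPDF
  rw [mul_pow, mul_pow, inv_pow, Real.sq_sqrt (by positivity), ← Real.exp_nat_mul,
    show ((2 : ℕ) : ℝ) * (-z ^ 2 / 2) = -z ^ 2 by push_cast; ring, Real.exp_neg]
  have hpi := Real.pi_gt_d4
  have hE0 := Real.exp_pos (z ^ 2)
  rw [← mul_inv, ← div_eq_mul_inv, div_le_iff₀ (by positivity)]
  have : 2 * 3.1415 * (5.51 * z ^ 2) ≤ 2 * Real.pi * Real.exp (z ^ 2) := by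
    gcongr
  linarith

/-- Product of the second-order Taylor bounds for `exp (-1.85 v)` and `1 / √(1 + v)`, with the
quadratic coefficient rounded up to absorb the higher powers; 1.85 is `(2.7 + 1) / 2`. -/
lemma exp_neg_div_sqrt_le {z v : ℝ} (hz : 1.644 ≤ z) (hv : 0 ≤ v) (hv1 : v ≤ 1) :
    Real.exp (-((z ^ 2 + 1) / 2 * v)) / √(1 + v) ≤ 1 - 2.35 * v + 3.02 * v ^ 2 := by
  have hz2 : (2.7 : ℝ) ≤ z ^ 2 := by nlinarith
  have h1 : Real.exp (-((z ^ 2 + 1) / 2 * v)) ≤ 1 - 1.85 * v + (1.85 * v) ^ 2 / 2 := by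
    have h := exp_neg_le_sum_of_odd (n := 3) (by decide) (u := 1.85 * v) (by positivity)
    norm_num [Finset.sum_range_succ, Nat.factorial] at h
    refine le_trans (Real.exp_le_exp.2 ?_) (h.trans (le_of_eq (by ring)))
    nlinarith
  have h2 : 1 / √(1 + v) ≤ 1 - v / 2 + 3 * v ^ 2 / 8 := by
    have h0 : 0 ≤ 1 - v / 2 + 3 * v ^ 2 / 8 := by nlinarith
    rw [div_le_iff₀ (by positivity)]
    refine (abs_le_of_sq_le_sq' ?_ (by positivity)).2
    rw [mul_pow, Real.sq_sqrt (by positivity)]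
    have : 0 ≤ v ^ 3 * (5 / 8 - 15 / 64 * v + 9 / 64 * v ^ 2) := by
      refine mul_nonneg (by positivity) (by nlinarith)
    nlinarith
  have h3 : 0 ≤ 1 - 1.85 * v + (1.85 * v) ^ 2 / 2 := le_trans (Real.exp_pos _).le h1
  rw [div_eq_mul_one_div]
  refine (mul_le_mul h1 h2 (by positivity) h3).trans ?_
  have : 0 ≤ v ^ 2 * (0.008 + 1.5 * v - 0.65 * v ^ 2) := mul_nonneg (by positivity) (by nlinarith)
  nlinarith [pow_nonneg hv 3, pow_nonneg hv 4]

/-- A polynomial minorant of `coverage z - coverage z 0` in terms of `v = q²`. -/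
noncomputable def coverageMinorant (v : ℝ) : ℝ :=
  0.17 * (-0.0991 * (v ^ 2 / 2 - 2.35 * (v ^ 3 / 3) + 3.02 * (v ^ 4 / 4)) +
    0.692 * (v ^ 3 / 3 - 2.35 * (v ^ 4 / 4) + 3.02 * (v ^ 5 / 5)))

lemma hasDerivAt_coverageMinorant (v : ℝ) : HasDerivAt coverageMinorant
    (0.17 * v * (1 - 2.35 * v + 3.02 * v ^ 2) * (-0.0991 + 0.692 * v)) v := by
  have hp (n : ℕ) (c : ℝ) : HasDerivAt (fun v : ℝ => v ^ n / c) (n * v ^ (n - 1) / c) v :=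
    (hasDerivAt_pow n v).div_const c
  have := ((((((hp 2 2).sub ((hp 3 3).const_mul 2.35)).add ((hp 4 4).const_mul 3.02)).const_mul
    (-0.0991)).add ((((hp 3 3).sub ((hp 4 4).const_mul 2.35)).add
    ((hp 5 5).const_mul 3.02)).const_mul 0.692)).const_mul 0.17)
  refine this.congr_deriv ?_
  norm_num
  ring

lemma le_coverageDeriv_of_le {z q : ℝ} (hz : 1.644 ≤ z) (hq : 0 ≤ q) (hq1 : q ≤ 1)
    (h : -0.0991 + 0.692 * q ^ 2 ≤ 0) :
    0.17 * q ^ 2 * (1 - 2.35 * q ^ 2 + 3.02 * (q ^ 2) ^ 2) * (-0.0991 + 0.692 * q ^ 2) * (2 * q) ≤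
      coverageDeriv z q := by
  have hz0 : 0 < z := by linarith
  have hv1 : q ^ 2 ≤ 1 := by nlinarith
  have hpdf := stdNormalPDF_pos z
  have hs := le_coverageSlope hz (sq_nonneg q) hv1
  refine le_trans ?_ (le_coverageDeriv hz0 hq hq1)
  have hw : z * stdNormalPDF z * (Real.exp (-((z ^ 2 + 1) / 2 * q ^ 2)) / √(1 + q ^ 2)) ≤
      0.17 * (1 - 2.35 * q ^ 2 + 3.02 * (q ^ 2) ^ 2) :=
    mul_le_mul (mul_stdNormalPDF_le hz) (exp_neg_div_sqrt_le hz (sq_nonneg q) hv1)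
      (by positivity) (by norm_num)
  set w := z * stdNormalPDF z * (Real.exp (-((z ^ 2 + 1) / 2 * q ^ 2)) / √(1 + q ^ 2)) with hw_def
  have hw0 : 0 ≤ w := by positivity
  calc _ = 2 * q * q ^ 2 * (0.17 * (1 - 2.35 * q ^ 2 + 3.02 * (q ^ 2) ^ 2) *
        (-0.0991 + 0.692 * q ^ 2)) := by ring
    _ ≤ 2 * q * q ^ 2 * (w * coverageSlope z (q ^ 2)) := by
      gcongr 2 * q * q ^ 2 * ?_
      -- The linear bound on the slope is nonpositive here, so enlarging the weight `w` makes the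
      -- product smaller.
      exact (mul_le_mul_of_nonpos_right hw h).trans (mul_le_mul_of_nonneg_left hs hw0)
    _ = _ := by rw [hw_def]; ring

lemma coverageMinorant_ge {v : ℝ} (hv : 0 ≤ v) (h : -0.0991 + 0.692 * v ≤ 0) :
    -0.00005 ≤ coverageMinorant v := by
  have hanti : AntitoneOn coverageMinorant (Set.Icc 0 (0.0991 / 0.692)) := by
    refine antitoneOn_of_deriv_nonpos (convex_Icc _ _)
      (fun v _ => (hasDerivAt_coverageMinorant v).continuousAt.continuousWithinAt)
      (fun v _ => (hasDerivAt_coverageMinorant v).differentiableAt.differentiableWithinAt)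
      fun v hv => ?_
    rw [interior_Icc] at hv
    rw [(hasDerivAt_coverageMinorant v).deriv]
    have h1 : v * 0.692 < 0.0991 := (lt_div_iff₀ (by norm_num)).1 hv.2
    have := hv.1
    refine mul_nonpos_of_nonneg_of_nonpos (mul_nonneg (by positivity) ?_) (by linarith)
    nlinarith
  have hle : v ≤ 0.0991 / 0.692 := by
    rw [le_div_iff₀ (by norm_num)]
    linarith
  refine le_trans ?_ (hanti ⟨hv, hle⟩ ⟨by norm_num, le_rfl⟩ hle)
  norm_num [coverageMinorant]

/-- At critical values of at least `1.644`, the coverage falls by at most `0.00005`. -/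
lemma coverage_ge {z q : ℝ} (hz : 1.644 ≤ z) (hq : 0 ≤ q) :
    coverage z 0 - 0.00005 ≤ coverage z q := by
  -- At `q = a` the linear lower bound for the slope changes sign: coverage can fall only before
  -- `a`.
  set a : ℝ := √(0.0991 / 0.692) with ha
  have ha0 : 0 ≤ a := Real.sqrt_nonneg _
  have ha2 : a ^ 2 = 0.0991 / 0.692 := Real.sq_sqrt (by norm_num)
  have ha1 : a ≤ 1 := by
    refine (abs_le_of_sq_le_sq' ?_ zero_le_one).2
    rw [ha2]
    norm_num
  have hneg {q : ℝ} (h0 : 0 ≤ q) (h : q ≤ a) : -0.0991 + 0.692 * q ^ 2 ≤ 0 := by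
    have : q ^ 2 ≤ a ^ 2 := by gcongr
    rw [ha2, le_div_iff₀ (by norm_num)] at this
    linarith
  have hsmall {q : ℝ} (h0 : 0 ≤ q) (h : q ≤ a) : coverage z 0 - 0.00005 ≤ coverage z q := by
    have hd (x : ℝ) := (hasDerivAt_coverage z x).sub
      ((hasDerivAt_coverageMinorant (x ^ 2)).comp x (hasDerivAt_pow 2 x))
    -- The substitution `v = q²` supplies the factor `2 q` in the derivative bound.
    have hmono : MonotoneOn (coverage z - coverageMinorant ∘ fun x => x ^ 2) (Set.Icc 0 a) := by
      refine monotoneOn_of_deriv_nonneg (convex_Icc _ _)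
        (fun x _ => (hd x).continuousAt.continuousWithinAt)
        (fun x _ => (hd x).differentiableAt.differentiableWithinAt) fun x hx => ?_
      rw [interior_Icc] at hx
      rw [(hd x).deriv, sub_nonneg]
      refine (le_of_eq ?_).trans
        (le_coverageDeriv_of_le hz hx.1.le (hx.2.le.trans ha1) (hneg hx.1.le hx.2.le))
      norm_num
    have h1 := hmono ⟨le_rfl, ha0⟩ ⟨h0, h⟩ h0
    have h2 := coverageMinorant_ge (sq_nonneg q) (hneg h0 h)
    have h3 : coverageMinorant 0 = 0 := by norm_num [coverageMinorant]
    simp only [Pi.sub_apply, Function.comp_apply, ne_eq, OfNat.ofNat_ne_zero, not_false_eq_true,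
      zero_pow, h3] at h1
    linarith
  rcases le_total q a with h | h
  · exact hsmall hq h
  refine (hsmall ha0 le_rfl).trans ?_
  have hmono : MonotoneOn (coverage z) (Set.Ici a) := by
    refine monotoneOn_of_deriv_nonneg (convex_Ici a) (continuous_coverage z).continuousOn
      (fun x _ => (hasDerivAt_coverage z x).differentiableAt.differentiableWithinAt) fun x hx => ?_
    rw [interior_Ici] at hx
    rw [(hasDerivAt_coverage z x).deriv]
    have hx0 : 0 ≤ x := ha0.trans (le_of_lt hx)
    rcases le_total 1 x with h1 | h1
    · exact (coverageDeriv_pos_of_one_le (by linarith) (by nlinarith) h1).le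
    · refine le_trans ?_ (le_coverageDeriv (by linarith) hx0 h1)
      have hs := le_coverageSlope hz (sq_nonneg x) (by nlinarith)
      have hx2 : a ^ 2 ≤ x ^ 2 := by
        have := le_of_lt (Set.mem_Ioi.1 hx)
        gcongr
      rw [ha2, div_le_iff₀ (by norm_num)] at hx2
      have := stdNormalPDF_pos z
      have : 0 ≤ coverageSlope z (x ^ 2) := by linarith
      have : 0 < z := by linarith
      positivity
  exact hmono (Set.mem_Ici.2 le_rfl) h h

/-! ### From the statistical model to the coverage function. -/

lemma coverageProb_Icc_eq {Ω : Type*} [MeasurableSpace Ω] {P : Measure Ω} {X : Ω → ℝ} {m s : ℝ}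
    (hX : HasLaw X (normalDist m s) P) (θ c : ℝ) :
    coverageProb P (fun ω => Set.Icc (X ω - c) (X ω + c)) θ =
      (normalDist m s).real (Set.Icc (θ - c) (θ + c)) := by
  refine Eq.trans ?_ (hX.measureReal_eq (p := fun x => x ∈ Set.Icc (θ - c) (θ + c))
    measurableSet_Icc)
  unfold coverageProb
  congr 1
  ext ω
  simp only [Set.mem_ofPred_eq, Set.mem_Icc]
  constructor <;> rintro ⟨h1, h2⟩ <;> constructor <;> linarith

namespace EqualMSEModel

variable {θ s₁ : ℝ}

lemma CP₁_eq (M : EqualMSEModel.{u} θ s₁) (hs : 0 < s₁) {α : ℝ} (h0 : 0 < α) (h1 : α < 1) :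
    M.CP₁ α = 1 - α := by
  have hz : 0 ≤ zCrit (1 - α / 2) := le_zCrit h0 h1 (by simp; linarith)
  have hzs : 0 ≤ zCrit (1 - α / 2) * s₁ := by positivity
  have h := coverageProb_Icc_eq M.law₁ θ (zCrit (1 - α / 2) * s₁)
  rw [normalDist_real_Icc hs (by linarith)] at h
  refine h.trans ?_
  rw [add_sub_cancel_left, sub_sub_cancel_left, neg_div, mul_div_cancel_right₀ _ hs.ne',
    stdNormalIntegral_neg]
  linarith [two_mul_stdNormalIntegral_zCrit h0 h1]

lemma CP₂_eq_coverage (M : EqualMSEModel.{u} θ s₁) (hs : 0 < s₁) {α : ℝ} (h0 : 0 < α) (h1 : α < 1)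
    (hs₂ : 0 < M.s₂) : M.CP₂ α = coverage (zCrit (1 - α / 2)) (|M.b₂| / M.s₂) := by
  have hz : 0 ≤ zCrit (1 - α / 2) := le_zCrit h0 h1 (by simp; linarith)
  have hzs : 0 ≤ zCrit (1 - α / 2) * s₁ := by positivity
  have h := coverageProb_Icc_eq M.law₂ θ (zCrit (1 - α / 2) * s₁)
  rw [normalDist_real_Icc hs₂ (by linarith)] at h
  refine h.trans ?_
  have hr : √(1 + (|M.b₂| / M.s₂) ^ 2) = s₁ / M.s₂ := by
    have hsq : 1 + (|M.b₂| / M.s₂) ^ 2 = (s₁ / M.s₂) ^ 2 := by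
      rw [div_pow, div_pow, sq_abs, ← M.equal_mse]
      field_simp
      ring
    rw [hsq, Real.sqrt_sq (by positivity)]
  unfold coverage
  rw [hr]
  generalize zCrit (1 - α / 2) = z
  have e1 : (θ + z * s₁ - (θ + M.b₂)) / M.s₂ = z * (s₁ / M.s₂) - M.b₂ / M.s₂ := by ring
  have e2 : (θ - z * s₁ - (θ + M.b₂)) / M.s₂ = -(z * (s₁ / M.s₂) + M.b₂ / M.s₂) := by ring
  rw [e1, e2, stdNormalIntegral_neg, sub_neg_eq_add]
  -- The sum of the two integrals is symmetric in the sign of the bias, so `|b₂|` may replace `b₂`.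
  rcases abs_choice M.b₂ with hb | hb <;> rw [hb]
  rw [neg_div, sub_neg_eq_add, ← sub_eq_add_neg, add_comm]

lemma abs_b₂_le (M : EqualMSEModel.{u} θ s₁) (hs : 0 < s₁) : |M.b₂| ≤ s₁ := by
  refine abs_le_of_sq_le_sq ?_ hs.le
  nlinarith [M.equal_mse, sq_nonneg M.s₂]

/-- Chebyshev's inequality for the coverage of `CI₂`. -/
lemma one_sub_le_CP₂ (M : EqualMSEModel.{u} θ s₁) (hs : 0 < s₁) {α : ℝ}
    (hz : 1 < zCrit (1 - α / 2)) :
    1 - (s₁ ^ 2 - |M.b₂| ^ 2) / ((zCrit (1 - α / 2) - 1) * s₁) ^ 2 ≤ M.CP₂ α := by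
  have h := coverageProb_Icc_eq M.law₂ θ (zCrit (1 - α / 2) * s₁)
  refine le_trans ?_ h.ge
  have hb := abs_le.1 (M.abs_b₂_le hs)
  generalize zCrit (1 - α / 2) = z at *
  have hz0 : 0 < z - 1 := by linarith
  have hc : 0 < (z - 1) * s₁ := by positivity
  have : IsProbabilityMeasure (normalDist (θ + M.b₂) M.s₂) := by
    unfold normalDist
    infer_instance
  have hcheb := meas_ge_le_variance_div_sq (μ := normalDist (θ + M.b₂) M.s₂) (X := id)
    (memLp_id_gaussianReal 2) hc
  rw [normalDist, variance_id_gaussianReal, ← normalDist] at hcheb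
  have hmean : ∫ x, id x ∂(normalDist (θ + M.b₂) M.s₂) = θ + M.b₂ := integral_id_gaussianReal
  rw [hmean, Real.coe_toNNReal _ (sq_nonneg _)] at hcheb
  have hcheb' : (normalDist (θ + M.b₂) M.s₂).real {x | (z - 1) * s₁ ≤ |id x - (θ + M.b₂)|} ≤
      M.s₂ ^ 2 / ((z - 1) * s₁) ^ 2 := ENNReal.toReal_le_of_le_ofReal (by positivity) hcheb
  have hcompl := probReal_compl_eq_one_sub (μ := normalDist (θ + M.b₂) M.s₂)
    (measurableSet_Icc (a := θ - z * s₁) (b := θ + z * s₁))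
  -- Since `|b₂| ≤ s₁`, the interval of half-width `z s₁` about `θ` contains all points within `(z -
  -- 1) s₁` of the mean `θ + b₂`.
  have hsub : (normalDist (θ + M.b₂) M.s₂).real (Set.Icc (θ - z * s₁) (θ + z * s₁))ᶜ ≤
      (normalDist (θ + M.b₂) M.s₂).real {x | (z - 1) * s₁ ≤ |id x - (θ + M.b₂)|} := by
    refine measureReal_mono fun x hx => ?_
    simp only [Set.mem_ofPred_eq, id]
    by_contra hlt
    obtain ⟨h1, h2⟩ := abs_lt.1 (not_le.1 hlt)
    exact hx ⟨by linarith, by linarith⟩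
  have hvar : M.s₂ ^ 2 = s₁ ^ 2 - |M.b₂| ^ 2 := by
    rw [sq_abs]
    linarith [M.equal_mse]
  rw [← hvar]
  linarith

lemma CP₂_le_one (M : EqualMSEModel.{u} θ s₁) (α : ℝ) : M.CP₂ α ≤ 1 :=
  measureReal_le_one

lemma CP₂_eq_one_of_s₂_eq_zero (M : EqualMSEModel.{u} θ s₁) (hs : 0 < s₁) {α : ℝ}
    (hz : 1 < zCrit (1 - α / 2)) (hs₂ : M.s₂ = 0) : M.CP₂ α = 1 := by
  refine le_antisymm (M.CP₂_le_one α) ?_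
  have h := M.one_sub_le_CP₂ hs hz
  have hmse := M.equal_mse
  rw [hs₂] at hmse
  rwa [sq_abs, show s₁ ^ 2 - M.b₂ ^ 2 = 0 by linarith, zero_div, sub_zero] at h

end EqualMSEModel

theorem theorem1 (θ s₁ : ℝ) (hs₁ : 0 < s₁) :
    -- the benchmark interval has exact coverage
    (∀ α : ℝ, 0 < α → α < 1 → ∀ M : EqualMSEModel.{u} θ s₁, M.CP₁ α = 1 - α) ∧
    -- at levels of at least 0.917, coverage is strictly above nominal under nonzero bias
    (∀ α : ℝ, 0 < α → 0.917 ≤ 1 - α → ∀ M : EqualMSEModel.{u} θ s₁,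
      M.b₂ ≠ 0 → 1 - α < M.CP₂ α) ∧
    -- at level 0.9, coverage is at least 90.00% (rounded), for any bias
    (∀ M : EqualMSEModel.{u} θ s₁, 0.89995 ≤ M.CP₂ 0.1) ∧
    -- at level 0.9, coverage tends to 1 as |b₂| → s₁ ...
    Tendsto (fun M : EqualMSEModel.{u} θ s₁ => M.CP₂ 0.1)
      (comap (fun M : EqualMSEModel.{u} θ s₁ => |M.b₂|) (𝓝 s₁)) (𝓝 1) ∧
    -- ... and does so increasingly
    (∃ β < s₁, ∀ M M' : EqualMSEModel.{u} θ s₁,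
      β ≤ |M.b₂| → |M.b₂| < |M'.b₂| → M.CP₂ 0.1 < M'.CP₂ 0.1) := by
  have h0 : (0 : ℝ) < 0.1 := by norm_num
  have h1 : (0.1 : ℝ) < 1 := by norm_num
  have hz : 1.644 ≤ zCrit (1 - 0.1 / 2) :=
    le_zCrit h0 h1 (two_mul_stdNormalIntegral_lt_nine_tenths.le.trans (by norm_num))
  have hz1 : 1 < zCrit (1 - 0.1 / 2) := by linarith
  refine ⟨fun α hα0 hα1 M => M.CP₁_eq hs₁ hα0 hα1, fun α hα0 hα M hb => ?_, fun M => ?_, ?_, ?_⟩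
  · have hα1 : α < 1 := by linarith
    have hz : 1.7325 ≤ zCrit (1 - α / 2) :=
      le_zCrit hα0 hα1 (two_mul_stdNormalIntegral_lt_917.le.trans hα)
    rcases M.s₂_nonneg.eq_or_lt with hs | hs
    · rw [M.CP₂_eq_one_of_s₂_eq_zero hs₁ (by linarith) hs.symm]
      linarith
    · rw [M.CP₂_eq_coverage hs₁ hα0 hα1 hs, ← two_mul_stdNormalIntegral_zCrit hα0 hα1,
        ← coverage_zero]
      have hq : 0 < |M.b₂| / M.s₂ := by positivity
      exact strictMonoOn_coverage_of_three_le (by linarith) (by nlinarith)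
        (Set.mem_Ici.2 le_rfl) hq.le hq
  · rcases M.s₂_nonneg.eq_or_lt with hs | hs
    · rw [M.CP₂_eq_one_of_s₂_eq_zero hs₁ hz1 hs.symm]
      norm_num
    · have h := coverage_ge hz (q := |M.b₂| / M.s₂) (by positivity)
      rw [coverage_zero, two_mul_stdNormalIntegral_zCrit h0 h1] at h
      rw [M.CP₂_eq_coverage hs₁ h0 h1 hs]
      linarith
  · refine tendsto_of_tendsto_of_tendsto_of_le_of_le ?_ tendsto_const_nhds
      (fun M => M.one_sub_le_CP₂ hs₁ hz1) (fun M => M.CP₂_le_one _)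
    have hcont : Continuous fun b : ℝ =>
        1 - (s₁ ^ 2 - b ^ 2) / ((zCrit (1 - 0.1 / 2) - 1) * s₁) ^ 2 := by fun_prop
    have h := hcont.tendsto s₁
    simp only [sub_self, zero_div, sub_zero] at h
    exact h.comp tendsto_comap
  -- At `|b₂| = s₁ / √2` the bias and standard deviation have equal size, so `q = 1`; beyond it
  -- `coverage` is strictly increasing.
  · have hβ : s₁ / √2 < s₁ := div_lt_self hs₁ (Real.lt_sqrt_of_sq_lt (by norm_num))
    refine ⟨s₁ / √2, hβ, fun M M' hM hlt => ?_⟩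
    have hsq : |M.b₂| ^ 2 < |M'.b₂| ^ 2 := by gcongr
    have hβsq : s₁ ^ 2 / 2 ≤ |M.b₂| ^ 2 := by
      have : (s₁ / √2) ^ 2 ≤ |M.b₂| ^ 2 := by gcongr
      rwa [div_pow, Real.sq_sqrt (by norm_num)] at this
    have hm := M.equal_mse
    have hm' := M'.equal_mse
    rw [← sq_abs M.b₂] at hm
    rw [← sq_abs M'.b₂] at hm'
    have hs : 0 < M.s₂ := M.s₂_nonneg.lt_of_ne fun h => by
      rw [← h] at hm
      nlinarith [sq_nonneg M'.s₂]
    rw [M.CP₂_eq_coverage hs₁ h0 h1 hs]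
    rcases M'.s₂_nonneg.eq_or_lt with hs' | hs'
    -- At the endpoint `|b₂| = s₁` the coverage is 1, above every value attained with `s₂ > 0`.
    · rw [M'.CP₂_eq_one_of_s₂_eq_zero hs₁ hz1 hs'.symm]
      exact coverage_lt_one _ _
    · rw [M'.CP₂_eq_coverage hs₁ h0 h1 hs']
      have hss : M'.s₂ < M.s₂ := lt_of_pow_lt_pow_left₀ 2 hs.le (by linarith)
      have hq : 1 ≤ |M.b₂| / M.s₂ := by
        rw [one_le_div hs]
        exact (abs_le_of_sq_le_sq' (by linarith) (abs_nonneg _)).2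
      have hqq : |M.b₂| / M.s₂ < |M'.b₂| / M'.s₂ := by gcongr
      exact strictMonoOn_coverage_Ici_one (by linarith) (by nlinarith) hq (hq.trans hqq.le) hqq
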